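/- Let $a,b,\eta,c,\rho>0$ and $\delta>1$, and let $f$ be a probability density of claim sizes, carried by $(0,\infty)$. Let $(\Omega,\mathcal F,\mathbb P)$ be a probability space carrying, for every $y\ge b$, a filtration $\mathbb F$ (complete and right-continuous) and a Hawkes claim process with initial intensity $y$: a counting process $N$ (with $N_0=0$ and unit jumps) and i.i.d. positive claim sizes $(Y_k)_{k\ge1}$ with density $f$, independent of $N$, such that $N$ and $\sum_{k\le N_t}Y_k$ are $\mathbb F$-adapted and the marked point process $(N,(Y_k))$ has $\mathbb F$-compensator $\lambda_t\,dt\,f(z)\,dz$, where $$d\lambda_t=a(b-\lambda_t)\,dt+\eta\,dN_t,\qquad \lambda_0=y .$$ (All these objects may depend on $y$.) For $x\in\mathbb R$ put $R_t=x+ct-\sum_{k=1}^{N_t}Y_k$. A strategy $\alpha=(Z,K)$ consists of $\mathbb F$-adapted non-decreasing processes, $Z$ (cumulative dividends) right-continuous with left limits and $Z_{0-}=0$, and $K$ (cumulative capital injections) left-continuous with right limits and $K_0=K_{0-}=0$. The controlled surplus is $X_t=R_t-Z_t+K_t$, with $X_{0-}=R_{0-}=x$. The strategy is admissible, $\alpha\in\mathcal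 A(x,y)$, if $Z_t-Z_{t-}\le (X_{t-}+R_t-R_{t-})^+$ for all $t\ge0$. The ruin time is $T^\alpha=\inf\{t\ge0: X_{t+}<0\}$ (with $\inf\emptyset=\infty$), and $$J_\alpha(x,y)=\mathbb E\Big[\int_{[0,T^\alpha]}e^{-\rho s}\,dZ_s-\delta\int_{[0,T^\alpha]}e^{-\rho s}\,dK_s\Big],\qquad v(x,y)=\sup_{\alpha\in\mathcal A(x,y)}J_\alpha(x,y),$$ where jumps at times $0$ and $T^\alpha$ are included (the jump of $K$ at $s$ being $K_{s+}-K_s$), and $J_\alpha(x,y)=-\infty$ if the expected discounted injections are infinite. Then, for every $x\ge0$, $$\lim_{y\to+\infty}v(x,y)=x .$$ -/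

import Mathlib

open MeasureTheory ProbabilityTheory Filter Topology
open scoped NNReal ENNReal

noncomputable section

namespace DividendHawkes

/-- Extension of a path on `[0, ∞)` to the real line by its value `0` at negative times;
this encodes the convention that the process is `0` at time `0-`. -/
def extendPath (G : ℝ≥0 → ℝ) (t : ℝ) : ℝ := if t < 0 then 0 else G t.toNNReal

lemma extendPath_mono {G : ℝ≥0 → ℝ} (hG : Monotone G) (h0 : 0 ≤ G 0) :
    Monotone (extendPath G) := by
  intro s t hst
  unfold extendPath
  split_ifs with hs ht ht
  · exact le_rfl
  · exact h0.trans (hG bot_le)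
  · exact absurd (hst.trans_lt ht) hs
  · exact hG (Real.toNNReal_le_toNNReal hst)

/-- The Lebesgue-Stieltjes measure `dG` on the line of a non-decreasing path `G` with `G_{0-} = 0`.
It charges `{t}` with the total jump `G_{t+} - G_{t-}`, in particular `{0}` with `G_{0+}`. -/
def pathMeasure (G : ℝ≥0 → ℝ) (hG : Monotone G) (h0 : 0 ≤ G 0) : Measure ℝ :=
  (extendPath_mono hG h0).stieltjesFunction.measure

/-- The law on the line of a claim size with density `f`. -/
def claimLaw (f : ℝ → ℝ) : Measure ℝ := volume.withDensity fun z => ENNReal.ofReal (f z)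

section

variable {Ω : Type*}

/-- The time of the claim number `k + 1` of the counting process `N` (meaningful when there is
such a claim). -/
def claimTime (N : ℝ≥0 → Ω → ℕ) (k : ℕ) (ω : Ω) : ℝ≥0 := sInf {t | k < N t ω}

open Classical in
/-- The sum of `H (τ_k, Y_k)` over all claims, for a non-negative random field `H`; the sequence
`Y` is indexed from `0`, so that `Y k` is the size of the claim number `k + 1`. -/
def sumOverClaims (N : ℝ≥0 → Ω → ℕ) (Y : ℕ → Ω → ℝ) (H : (ℝ≥0 × Ω) × ℝ → ℝ≥0∞) (ω : Ω) : ℝ≥0∞ :=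
  ∑' k : ℕ, if ∃ t, k < N t ω then H ((claimTime N k ω, ω), Y k ω) else 0

end

/-- A Hawkes claim process with parameters `a, b, η`, initial intensity `y` and claim-size
density `f`, on the probability space `(Ω, P)`, with a filtration satisfying the usual conditions.
The last field is the definition of "the claim process has `𝔽`-intensity `λ` and claim sizes
of density `f`": the `𝔽`-compensator of the marked point process is `λ_s ds f(z) dz`. -/
structure HawkesClaims {Ω : Type*} [mΩ : MeasurableSpace Ω] (P : Measure Ω)
    (a b η : ℝ) (f : ℝ → ℝ) (y : ℝ) where
  /-- the filtration, right-continuous and complete -/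
  𝔽 : Filtration ℝ≥0 mΩ
  rightContinuous : 𝔽.IsRightContinuous
  complete : ∀ t (s : Set Ω), P s = 0 → MeasurableSet[𝔽 t] s
  /-- the number of claims up to time `t` -/
  N : ℝ≥0 → Ω → ℕ
  /-- the claim sizes -/
  Y : ℕ → Ω → ℝ
  /-- the intensity of the claims -/
  lam : ℝ≥0 → Ω → ℝ
  N_zero : ∀ ω, N 0 ω = 0
  N_mono : ∀ ω, Monotone fun t => N t ω
  N_rightCont : ∀ ω t, ContinuousWithinAt (fun s => N s ω) (Set.Ici t) t
  /-- claims occur one at a time: `N_t ≤ N_{t-} + 1` -/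
  N_jump : ∀ ω t, 0 < t → ∃ s < t, N t ω ≤ N s ω + 1
  N_adapted : Adapted 𝔽 N
  Y_measurable : ∀ k, Measurable (Y k)
  Y_pos : ∀ k, ∀ᵐ ω ∂P, 0 < Y k ω
  Y_law : ∀ k, P.map (Y k) = claimLaw f
  Y_indep : iIndepFun Y P
  Y_indep_N : IndepFun (fun ω k => Y k ω) (fun ω t => N t ω) P
  /-- a claim size is known once the claim has occurred -/
  claims_adapted : Adapted 𝔽 fun t ω => ∑ k ∈ Finset.range (N t ω), Y k ω
  lam_intervalIntegrable : ∀ ω (t : ℝ≥0),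
    IntervalIntegrable (fun s : ℝ => lam s.toNNReal ω) volume 0 t
  /-- `dλ_t = a (b - λ_t) dt + η dN_t` with `λ_0 = y` -/
  lam_eq : ∀ ω (t : ℝ≥0),
    lam t ω = y + (∫ s in (0 : ℝ)..t, a * (b - lam s.toNNReal ω)) + η * N t ω
  intensity : ∀ H : (ℝ≥0 × Ω) × ℝ → ℝ≥0∞,
    Measurable[MeasurableSpace.prod 𝔽.predictable (borel ℝ)] H →
    ∫⁻ ω, sumOverClaims N Y H ω ∂P =
      ∫⁻ ω, (∫⁻ s in Set.Ioi (0 : ℝ), (∫⁻ z, H ((s.toNNReal, ω), z) ∂claimLaw f) *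
        ENNReal.ofReal (lam s.toNNReal ω)) ∂P

/-- A pair of cumulative dividends `Z` (adapted, non-decreasing, right-continuous, `Z_{0-} = 0`)
and cumulative capital injections `K` (adapted, non-decreasing, left-continuous,
`K_0 = K_{0-} = 0`; a capital injection at time `0` is the jump `K_{0+} - K_0`). -/
structure Strategy {Ω : Type*} [mΩ : MeasurableSpace Ω] (𝔽 : Filtration ℝ≥0 mΩ) where
  Z : ℝ≥0 → Ω → ℝ
  K : ℝ≥0 → Ω → ℝ
  Z_adapted : Adapted 𝔽 Z
  Z_mono : ∀ ω, Monotone fun t => Z t ω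
  Z_rightCont : ∀ ω t, ContinuousWithinAt (fun s => Z s ω) (Set.Ici t) t
  Z_zero : ∀ ω, 0 ≤ Z 0 ω
  K_adapted : Adapted 𝔽 K
  K_mono : ∀ ω, Monotone fun t => K t ω
  K_leftCont : ∀ ω t, ContinuousWithinAt (fun s => K s ω) (Set.Iic t) t
  K_zero : ∀ ω, K 0 ω = 0

section

variable {Ω : Type*} [mΩ : MeasurableSpace Ω] {P : Measure Ω} {a b η : ℝ} {f : ℝ → ℝ} {y : ℝ}

/-- The uncontrolled reserve `R^x_t = x + c t - ∑_{k ≤ N_t} Y_k`. -/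
def reserve (M : HawkesClaims P a b η f y) (c x : ℝ) (t : ℝ≥0) (ω : Ω) : ℝ :=
  x + c * t - ∑ k ∈ Finset.range (M.N t ω), M.Y k ω

/-- The controlled surplus `X_t = R^x_t - Z_t + K_t`. -/
def surplus (M : HawkesClaims P a b η f y) (c x : ℝ) (α : Strategy M.𝔽) (t : ℝ≥0) (ω : Ω) : ℝ :=
  reserve M c x t ω - α.Z t ω + α.K t ω

/-- Dividends cannot exceed the available reserve:
`Z_t - Z_{t-} ≤ (X_{t-} + R_t - R_{t-})^+`, which at `t = 0`, where `Z_{0-} = 0` and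
`X_{0-} = x`, reads `Z_0 ≤ x^+`. -/
def IsAdmissible (M : HawkesClaims P a b η f y) (c x : ℝ) (α : Strategy M.𝔽) : Prop :=
  ∀ ω, α.Z 0 ω ≤ max x 0 ∧
    ∀ t, 0 < t →
      α.Z t ω - Function.leftLim (fun s => α.Z s ω) t ≤
        max (Function.leftLim (fun s => surplus M c x α s ω) t +
          (reserve M c x t ω - Function.leftLim (fun s => reserve M c x s ω) t)) 0

/-- The ruin time `T = inf {t ≥ 0 : X_{t+} < 0}`, equal to `∞` if there is no such `t`. -/
def ruinTime (M : HawkesClaims P a b η f y) (c x : ℝ) (α : Strategy M.𝔽) (ω : Ω) : ℝ≥0∞ :=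
  ⨅ (t : ℝ≥0) (_ : Function.rightLim (fun s => surplus M c x α s ω) t < 0), (t : ℝ≥0∞)

/-- The times `0 ≤ s ≤ T`. -/
def untilRuin (M : HawkesClaims P a b η f y) (c x : ℝ) (α : Strategy M.𝔽) (ω : Ω) : Set ℝ :=
  {s | 0 ≤ s ∧ ENNReal.ofReal s ≤ ruinTime M c x α ω}

/-- `E [∫_{[0, T]} e^{-ρ s} dZ_s]`. -/
def expectedDividends (M : HawkesClaims P a b η f y) (c ρ x : ℝ) (α : Strategy M.𝔽) : ℝ≥0∞ :=
  ∫⁻ ω, (∫⁻ s in untilRuin M c x α ω, ENNReal.ofReal (Real.exp (-ρ * s))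
    ∂pathMeasure (fun t => α.Z t ω) (α.Z_mono ω) (α.Z_zero ω)) ∂P

/-- `E [∫_{[0, T]} e^{-ρ s} dK_s]`. -/
def expectedInjections (M : HawkesClaims P a b η f y) (c ρ x : ℝ) (α : Strategy M.𝔽) : ℝ≥0∞ :=
  ∫⁻ ω, (∫⁻ s in untilRuin M c x α ω, ENNReal.ofReal (Real.exp (-ρ * s))
    ∂pathMeasure (fun t => α.K t ω) (α.K_mono ω) (α.K_zero ω).ge) ∂P

/-- The expected discounted dividends minus `δ` times the expected discounted injections. It is an
extended real, equal to `-∞` when the expected cost of the injections is infinite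
(in `EReal`, `⊤ - ⊤ = ⊥`). -/
def reward (M : HawkesClaims P a b η f y) (c ρ δ x : ℝ) (α : Strategy M.𝔽) : EReal :=
  (expectedDividends M c ρ x α : EReal) - (δ : EReal) * (expectedInjections M c ρ x α : EReal)

/-- The value function: the supremum of the reward over all admissible strategies. -/
def value (M : HawkesClaims P a b η f y) (c ρ δ x : ℝ) : EReal :=
  ⨆ (α : Strategy M.𝔽) (_ : IsAdmissible M c x α), reward M c ρ δ x α

end

end DividendHawkes

end

/-!
Discounting at rate `ρ` amounts to stopping at an independent `Exp(ρ)` time `t`: discounted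
dividends minus discounted injections up to the ruin time `T` are the mean over `t` of
`Z_{t ∧ T} - K_{(t ∧ T)+}`. Since dividends are paid out of the available reserve, this difference
is at most `x + c ε + (c t - S_ε)⁺`, where `S_ε` is the total of the claims up to time `ε`, and by
memorylessness the mean of `(c t - S_ε)⁺` is `(c / ρ) e^{-(ρ / c) S_ε}`.

As long as fewer than `n` claims have occurred, the intensity integrates over `[0, ε]` to at least a
fixed multiple of `y - O(1)`, whereas by the compensator formula the expected intensity accumulated
before the `n`-th claim is at most `n`. Hence `P (N_ε < n)` is of order `1 / y`, and
`E e^{-(ρ / c) S_ε} → 0` as `y → ∞`. Letting `ε → 0` gives the upper bound `x`; paying out `x` at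
time `0` attains it.
-/

namespace DividendHawkes

section ExponentialTime

variable {ρ : ℝ}

instance : NullSingletonClass (expMeasure ρ) := by
  unfold expMeasure gammaMeasure
  infer_instance

lemma expMeasure_Ici (hρ : 0 < ρ) {s : ℝ} (hs : 0 ≤ s) :
    expMeasure ρ (Set.Ici s) = ENNReal.ofReal (Real.exp (-ρ * s)) := by
  have := isProbabilityMeasure_expMeasure hρ
  have hle : Real.exp (-(ρ * s)) ≤ 1 := Real.exp_le_one_iff.mpr (neg_nonpos.mpr (by positivity))
  rw [← measure_congr Ioi_ae_eq_Ici, ← Set.compl_Iic, prob_compl_eq_one_sub measurableSet_Iic,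
    ← ofReal_cdf, cdf_expMeasure_eq hρ, if_pos hs, ← ENNReal.ofReal_one,
    ← ENNReal.ofReal_sub _ (sub_nonneg.mpr hle), sub_sub_cancel, neg_mul]

lemma ae_expMeasure_nonneg (hρ : 0 < ρ) : ∀ᵐ t ∂expMeasure ρ, 0 ≤ t := by
  have := isProbabilityMeasure_expMeasure hρ
  exact (mem_ae_iff_prob_eq_one measurableSet_Ici).mpr
    ((expMeasure_Ici hρ le_rfl).trans (by simp))

lemma setLIntegral_exp_neg_mul (hρ : 0 < ρ) (μ : Measure ℝ) [SFinite μ] {A : Set ℝ}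
    (hA : MeasurableSet A) (hA0 : A ⊆ Set.Ici 0) :
    ∫⁻ s in A, ENNReal.ofReal (Real.exp (-ρ * s)) ∂μ =
      ∫⁻ t, μ (A ∩ Set.Iic t) ∂expMeasure ρ := by
  have := isProbabilityMeasure_expMeasure hρ
  have hle : MeasurableSet {p : ℝ × ℝ | p.1 ≤ p.2} :=
    measurableSet_le measurable_fst measurable_snd
  calc ∫⁻ s in A, ENNReal.ofReal (Real.exp (-ρ * s)) ∂μ
      = ∫⁻ s in A, expMeasure ρ (Set.Ici s) ∂μ :=
        setLIntegral_congr_fun hA fun s hs => (expMeasure_Ici hρ (hA0 hs)).symm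
    _ = ((μ.restrict A).prod (expMeasure ρ)) {p | p.1 ≤ p.2} := (Measure.prod_apply hle).symm
    _ = ∫⁻ t, μ.restrict A (Set.Iic t) ∂expMeasure ρ := Measure.prod_apply_symm hle
    _ = ∫⁻ t, μ (A ∩ Set.Iic t) ∂expMeasure ρ := by
        simp_rw [Measure.restrict_apply measurableSet_Iic, Set.inter_comm A]

lemma lintegral_ofReal_sub_expMeasure (hρ : 0 < ρ) {s : ℝ} (hs : 0 ≤ s) :
    ∫⁻ t, ENNReal.ofReal (t - s) ∂expMeasure ρ = ENNReal.ofReal (Real.exp (-ρ * s) / ρ) := by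
  calc ∫⁻ t, ENNReal.ofReal (t - s) ∂expMeasure ρ
      = ∫⁻ u in Set.Ioi s, ENNReal.ofReal (Real.exp (-ρ * u)) := by
        rw [setLIntegral_exp_neg_mul hρ volume measurableSet_Ioi (Set.Ioi_subset_Ici hs)]
        simp_rw [Set.Ioi_inter_Iic, Real.volume_Ioc]
    _ = ENNReal.ofReal (Real.exp (-ρ * s) / ρ) := by
        rw [← ofReal_integral_eq_lintegral_ofReal
          (integrableOn_exp_mul_Ioi (neg_lt_zero.mpr hρ) s) (ae_of_all _ fun _ => by positivity),
          integral_exp_mul_Ioi (neg_lt_zero.mpr hρ), neg_div_neg_eq]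

lemma lintegral_ofReal_mul_sub_expMeasure (hρ : 0 < ρ) {c s : ℝ} (hc : 0 < c) (hs : 0 ≤ s) :
    ∫⁻ t, ENNReal.ofReal (c * t - s) ∂expMeasure ρ =
      ENNReal.ofReal (c / ρ) * ENNReal.ofReal (Real.exp (-(ρ / c) * s)) := by
  have hscale : ∀ t, ENNReal.ofReal (c * t - s) = ENNReal.ofReal c * ENNReal.ofReal (t - s / c) :=
    fun t => by rw [← ENNReal.ofReal_mul hc.le, mul_sub, mul_div_cancel₀ s hc.ne']
  simp_rw [hscale]
  rw [lintegral_const_mul _ (by fun_prop), lintegral_ofReal_sub_expMeasure hρ (by positivity),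
    ← ENNReal.ofReal_mul hc.le, ← ENNReal.ofReal_mul (by positivity)]
  ring_nf

end ExponentialTime

section Path

variable {G : ℝ≥0 → ℝ} (hG : Monotone G) (h0 : 0 ≤ G 0)

instance : SFinite (pathMeasure G hG h0) := by
  unfold pathMeasure
  infer_instance

include hG h0 in
lemma rightLim_extendPath_coe (t : ℝ≥0) :
    Function.rightLim (extendPath G) t = Function.rightLim G t := by
  have hcoe : Tendsto ((↑) : ℝ≥0 → ℝ) (𝓝[>] t) (𝓝[>] (t : ℝ)) :=
    NNReal.continuous_coe.continuousWithinAt.tendsto_nhdsWithin fun _ hs =>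
      NNReal.coe_lt_coe.mpr hs
  refine tendsto_nhds_unique ?_ (hG.tendsto_rightLim t)
  refine (((extendPath_mono hG h0).tendsto_rightLim t).comp hcoe).congr fun s => ?_
  simp [extendPath]

lemma rightLim_extendPath_of_neg {t : ℝ} (ht : t < 0) :
    Function.rightLim (extendPath G) t = 0 := by
  refine rightLim_eq_of_tendsto (tendsto_const_nhds.congr' ?_)
  filter_upwards [nhdsWithin_le_nhds (Iio_mem_nhds ht)] with s hs
  exact (if_pos hs).symm

lemma pathMeasure_Icc_zero (r : ℝ≥0) :
    pathMeasure G hG h0 (Set.Icc 0 (r : ℝ)) = ENNReal.ofReal (Function.rightLim G r) := by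
  have hleft : Function.leftLim (extendPath_mono hG h0).stieltjesFunction 0 = 0 := by
    refine leftLim_eq_of_tendsto (tendsto_const_nhds.congr' ?_)
    filter_upwards [self_mem_nhdsWithin] with s hs
    rw [Monotone.stieltjesFunction_eq, rightLim_extendPath_of_neg hs]
  rw [pathMeasure, StieltjesFunction.measure_Icc, hleft, sub_zero, Monotone.stieltjesFunction_eq,
    rightLim_extendPath_coe hG h0]

lemma setOf_ofReal_le_inter_Iic (T : ℝ≥0∞) {t : ℝ} (ht : 0 ≤ t) :
    {s : ℝ | 0 ≤ s ∧ ENNReal.ofReal s ≤ T} ∩ Set.Iic t =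
      Set.Icc 0 ((min (ENNReal.ofReal t) T).toNNReal : ℝ) := by
  have hfin : min (ENNReal.ofReal t) T ≠ ∞ := ne_top_of_le_ne_top ENNReal.ofReal_ne_top inf_le_left
  ext s
  simp only [Set.mem_inter_iff, Set.mem_ofPred_eq, Set.mem_Iic, Set.mem_Icc, and_assoc,
    and_congr_right_iff]
  intro _
  rw [ENNReal.coe_toNNReal_eq_toReal, ← ENNReal.ofReal_le_iff_le_toReal hfin, le_min_iff,
    ENNReal.ofReal_le_ofReal_iff ht, and_comm]

lemma setLIntegral_exp_neg_mul_pathMeasure {ρ : ℝ} (hρ : 0 < ρ) (T : ℝ≥0∞) :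
    ∫⁻ s in {s | 0 ≤ s ∧ ENNReal.ofReal s ≤ T}, ENNReal.ofReal (Real.exp (-ρ * s))
        ∂pathMeasure G hG h0 =
      ∫⁻ t, ENNReal.ofReal (Function.rightLim G (min (ENNReal.ofReal t) T).toNNReal)
        ∂expMeasure ρ := by
  have hmeas : MeasurableSet {s : ℝ | 0 ≤ s ∧ ENNReal.ofReal s ≤ T} :=
    measurableSet_Ici.inter (measurableSet_le ENNReal.measurable_ofReal measurable_const)
  rw [setLIntegral_exp_neg_mul hρ _ hmeas fun s hs => hs.1]
  refine lintegral_congr_ae ?_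
  filter_upwards [ae_expMeasure_nonneg hρ] with t ht
  rw [setOf_ofReal_le_inter_Iic T ht, pathMeasure_Icc_zero]

end Path

section Comparison

variable {l : ℝ → ℝ} {a T : ℝ}

lemma integral_exp_mul_add_mul_integral (hl : IntervalIntegrable l volume 0 T) :
    ∫ s in 0..T, Real.exp (a * (s - T)) * (l s + a * ∫ u in 0..s, l u) = ∫ s in 0..T, l s := by
  set E : ℝ → ℝ := fun s => Real.exp (a * (s - T))
  set L : ℝ → ℝ := fun s => ∫ u in 0..s, l u
  have hE : ∀ s, HasDerivAt E (E s * a) s := fun s => by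
    simpa using (((hasDerivAt_id s).sub_const T).const_mul a).exp
  have hEac : AbsolutelyContinuousOnInterval E 0 T :=
    (by fun_prop : ContDiff ℝ 1 E).contDiffOn.absolutelyContinuousOnInterval
  have hLac : AbsolutelyContinuousOnInterval L 0 T :=
    hl.absolutelyContinuousOnInterval_intervalIntegral Set.left_mem_uIcc
  calc ∫ s in 0..T, E s * (l s + a * L s)
      = ∫ s in 0..T, deriv E s * L s + E s * deriv L s := by
        refine intervalIntegral.integral_congr_ae ?_
        filter_upwards [hl.ae_hasDerivAt_integral] with s hs hsT
        rw [(hE s).deriv, (hs (Set.uIoc_subset_uIcc hsT) 0 Set.left_mem_uIcc).deriv]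
        ring
    _ = E T * L T - E 0 * L 0 := hEac.integral_deriv_mul_eq_sub hLac
    _ = ∫ s in 0..T, l s := by simp [E, L]

lemma mul_integral_exp_le_integral (hT : 0 ≤ T) (hl : IntervalIntegrable l volume 0 T) {g : ℝ}
    (hg : ∀ t ∈ Set.Icc 0 T, g ≤ l t + a * ∫ s in 0..t, l s) :
    g * ∫ s in 0..T, Real.exp (a * (s - T)) ≤ ∫ s in 0..T, l s := by
  rw [← integral_exp_mul_add_mul_integral (a := a) hl, ← intervalIntegral.integral_const_mul]
  have hexp : Continuous fun s => Real.exp (a * (s - T)) := by fun_prop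
  have hL := hl.absolutelyContinuousOnInterval_intervalIntegral Set.left_mem_uIcc
  refine intervalIntegral.integral_mono_on hT ((hexp.const_mul g).intervalIntegrable 0 T)
    ((hl.add (hL.continuousOn.intervalIntegrable.const_mul a)).continuousOn_mul hexp.continuousOn)
    fun t ht => ?_
  rw [mul_comm]
  exact mul_le_mul_of_nonneg_left (hg t ht) (Real.exp_nonneg _)

lemma integral_exp_mul_sub_pos (hT : 0 < T) : 0 < ∫ s in 0..T, Real.exp (a * (s - T)) :=
  intervalIntegral.intervalIntegral_pos_of_pos
    (Continuous.intervalIntegrable (by fun_prop) 0 T) (fun _ => Real.exp_pos _) hT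

lemma ofReal_integral_le_lintegral {Ω : Type*} [MeasurableSpace Ω] {μ : Measure Ω} {g : Ω → ℝ}
    (hg : Integrable g μ) :
    ENNReal.ofReal (∫ ω, g ω ∂μ) ≤ ∫⁻ ω, ENNReal.ofReal (g ω) ∂μ := by
  rw [integral_eq_lintegral_pos_part_sub_lintegral_neg_part hg]
  exact (ENNReal.ofReal_le_ofReal (sub_le_self _ ENNReal.toReal_nonneg)).trans
    ENNReal.ofReal_toReal_le

end Comparison

section ClaimSizes

/-- The Laplace transform of the law of a claim size with density `f`. -/
noncomputable def claimLaplace (f : ℝ → ℝ) (θ : ℝ) : ℝ≥0∞ :=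
  ∫⁻ z, ENNReal.ofReal (Real.exp (-θ * z)) ∂claimLaw f

variable {Ω : Type*} [mΩ : MeasurableSpace Ω] {P : Measure Ω} {a b η : ℝ} {f : ℝ → ℝ} {y θ : ℝ}

lemma lintegral_exp_neg_mul_lt_one [IsProbabilityMeasure P] {X : Ω → ℝ}
    (hX : ∀ᵐ ω ∂P, 0 < X ω) (hθ : 0 < θ) :
    ∫⁻ ω, ENNReal.ofReal (Real.exp (-θ * X ω)) ∂P < 1 := by
  have hlt : ∀ᵐ ω ∂P, ENNReal.ofReal (Real.exp (-θ * X ω)) < 1 := by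
    filter_upwards [hX] with ω hω
    rw [ENNReal.ofReal_lt_one, Real.exp_lt_one_iff, neg_mul]
    exact neg_neg_of_pos (mul_pos hθ hω)
  have hle : ∫⁻ ω, ENNReal.ofReal (Real.exp (-θ * X ω)) ∂P ≤ ∫⁻ _, 1 ∂P :=
    lintegral_mono_ae (hlt.mono fun _ h => h.le)
  rw [lintegral_one, measure_univ] at hle
  simpa using lintegral_strict_mono (NeZero.ne P) aemeasurable_const
    (ne_top_of_le_ne_top ENNReal.one_ne_top hle) hlt

variable (M : HawkesClaims P a b η f y)

lemma lintegral_exp_neg_mul_claim (θ : ℝ) (k : ℕ) :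
    ∫⁻ ω, ENNReal.ofReal (Real.exp (-θ * M.Y k ω)) ∂P = claimLaplace f θ := by
  rw [claimLaplace, ← M.Y_law k, lintegral_map (by fun_prop) (M.Y_measurable k)]

include M in
lemma claimLaplace_lt_one [IsProbabilityMeasure P] (hθ : 0 < θ) : claimLaplace f θ < 1 := by
  rw [← lintegral_exp_neg_mul_claim M θ 0]
  exact lintegral_exp_neg_mul_lt_one (M.Y_pos 0) hθ

lemma lintegral_exp_neg_mul_sum_claims (θ : ℝ) (n : ℕ) :
    ∫⁻ ω, ENNReal.ofReal (Real.exp (-θ * ∑ k ∈ Finset.range n, M.Y k ω)) ∂P =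
      claimLaplace f θ ^ n := by
  have hmeas : Measurable fun z : ℝ => ENNReal.ofReal (Real.exp (-θ * z)) := by fun_prop
  simp_rw [Finset.mul_sum, Real.exp_sum,
    ENNReal.ofReal_prod_of_nonneg fun _ _ => Real.exp_nonneg _]
  rw [lintegral_prod_eq_prod_lintegral_of_indepFun _
    (fun k ω => ENNReal.ofReal (Real.exp (-θ * M.Y k ω))) (M.Y_indep.comp _ fun _ => hmeas)
    fun k => hmeas.comp (M.Y_measurable k)]
  simp only [lintegral_exp_neg_mul_claim, Finset.prod_const, Finset.card_range]

end ClaimSizes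

section Surplus

variable {Ω : Type*} [mΩ : MeasurableSpace Ω] {P : Measure Ω} {a b η : ℝ} {f : ℝ → ℝ} {y : ℝ}
  (M : HawkesClaims P a b η f y) {c x : ℝ} {ω : Ω}

/-- The total amount `∑_{k ≤ N_t} Y_k` of the claims up to time `t`. -/
noncomputable def aggregateClaims (t : ℝ≥0) (ω : Ω) : ℝ := ∑ k ∈ Finset.range (M.N t ω), M.Y k ω

lemma tendsto_reserve (c x : ℝ) {F : Filter ℝ≥0} {t : ℝ≥0} {n : ℕ} (hF : F ≤ 𝓝 t)
    (hN : Tendsto (fun s => M.N s ω) F (𝓝 n)) :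
    Tendsto (fun s => reserve M c x s ω) F
      (𝓝 (x + c * t - ∑ k ∈ Finset.range n, M.Y k ω)) := by
  have hlin : Tendsto (fun s : ℝ≥0 => x + c * (s : ℝ)) F (𝓝 (x + c * t)) :=
    ((by fun_prop : Continuous fun s : ℝ≥0 => x + c * (s : ℝ)).tendsto t).mono_left hF
  exact hlin.sub ((continuous_of_discreteTopology
    (f := fun n => ∑ k ∈ Finset.range n, M.Y k ω)).continuousAt.tendsto.comp hN)

lemma tendsto_reserve_nhdsGT (c x : ℝ) (t : ℝ≥0) (ω : Ω) :
    Tendsto (fun s => reserve M c x s ω) (𝓝[>] t) (𝓝 (reserve M c x t ω)) :=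
  tendsto_reserve M c x nhdsWithin_le_nhds
    ((M.N_rightCont ω t).mono Set.Ioi_subset_Ici_self).tendsto

lemma tendsto_reserve_nhdsLT (c x : ℝ) (t : ℝ≥0) (ω : Ω) :
    Tendsto (fun s => reserve M c x s ω) (𝓝[<] t) (𝓝 (x + c * t -
      ∑ k ∈ Finset.range (Function.leftLim (fun s => M.N s ω) t), M.Y k ω)) :=
  tendsto_reserve M c x nhdsWithin_le_nhds ((M.N_mono ω).tendsto_leftLim t)

variable {M} {α : Strategy M.𝔽} {t : ℝ≥0}

lemma dividends_le_of_lt_ruinTime (ht : (t : ℝ≥0∞) < ruinTime M c x α ω) :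
    α.Z t ω ≤ reserve M c x t ω + Function.rightLim (fun s => α.K s ω) t := by
  have hX : 0 ≤ Function.rightLim (fun s => surplus M c x α s ω) t := by
    by_contra! h
    exact ht.not_ge (iInf₂_le t h)
  have hZ : Tendsto (fun s => α.Z s ω) (𝓝[>] t) (𝓝 (α.Z t ω)) :=
    ((α.Z_rightCont ω t).mono Set.Ioi_subset_Ici_self).tendsto
  have hlim : Tendsto (fun s => surplus M c x α s ω) (𝓝[>] t)
      (𝓝 (reserve M c x t ω - α.Z t ω + Function.rightLim (fun s => α.K s ω) t)) :=
    ((tendsto_reserve_nhdsGT M c x t ω).sub hZ).add ((α.K_mono ω).tendsto_rightLim t)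
  rw [rightLim_eq_of_tendsto hlim] at hX
  linarith

lemma leftLim_dividends_le (ht0 : 0 < t) (ht : (t : ℝ≥0∞) ≤ ruinTime M c x α ω) :
    Function.leftLim (fun s => α.Z s ω) t ≤ x + c * t -
      ∑ k ∈ Finset.range (Function.leftLim (fun s => M.N s ω) t), M.Y k ω + α.K t ω := by
  have : (𝓝[<] t).NeBot := nhdsLT_neBot_of_exists_lt ⟨0, ht0⟩
  refine le_of_tendsto_of_tendsto ((α.Z_mono ω).tendsto_leftLim t)
    ((tendsto_reserve_nhdsLT M c x t ω).add tendsto_const_nhds) ?_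
  filter_upwards [self_mem_nhdsWithin] with s hs
  have hZ := dividends_le_of_lt_ruinTime ((ENNReal.coe_lt_coe.mpr hs).trans_le ht)
  have hK := (α.K_mono ω).rightLim_le hs
  linarith

lemma IsAdmissible.dividends_le_max (hα : IsAdmissible M c x α) (ht0 : 0 < t) :
    α.Z t ω ≤ max (reserve M c x t ω + α.K t ω) (Function.leftLim (fun s => α.Z s ω) t) := by
  have : (𝓝[<] t).NeBot := nhdsLT_neBot_of_exists_lt ⟨0, ht0⟩
  have hR := tendsto_reserve_nhdsLT M c x t ω
  have hK : Tendsto (fun s => α.K s ω) (𝓝[<] t) (𝓝 (α.K t ω)) :=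
    ((α.K_leftCont ω t).mono Set.Iio_subset_Iic_self).tendsto
  have hX : Tendsto (fun s => surplus M c x α s ω) (𝓝[<] t) _ :=
    (hR.sub ((α.Z_mono ω).tendsto_leftLim t)).add hK
  have hZ := (hα ω).2 t ht0
  rw [leftLim_eq_of_tendsto hX, leftLim_eq_of_tendsto hR] at hZ
  rw [le_max_iff] at hZ ⊢
  exact hZ.imp (fun h => by linarith) fun h => by linarith

lemma IsAdmissible.dividends_add_claims_le (hα : IsAdmissible M c x α) (hx : 0 ≤ x)
    (hY : ∀ k, 0 ≤ M.Y k ω) (ht : (t : ℝ≥0∞) ≤ ruinTime M c x α ω) :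
    α.Z t ω + ∑ k ∈ Finset.range (Function.leftLim (fun s => M.N s ω) t), M.Y k ω ≤
      x + c * t + Function.rightLim (fun s => α.K s ω) t := by
  have hK : α.K t ω ≤ Function.rightLim (fun s => α.K s ω) t := (α.K_mono ω).le_rightLim le_rfl
  have hN : Function.leftLim (fun s => M.N s ω) t ≤ M.N t ω := (M.N_mono ω).leftLim_le le_rfl
  have hS : ∑ k ∈ Finset.range (Function.leftLim (fun s => M.N s ω) t), M.Y k ω ≤
      ∑ k ∈ Finset.range (M.N t ω), M.Y k ω :=
    Finset.sum_le_sum_of_subset_of_nonneg (Finset.range_subset_range.mpr hN) fun k _ _ => hY k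
  rcases eq_zero_or_pos t with rfl | ht0
  · have hZ := (hα ω).1
    rw [max_eq_left hx] at hZ
    simp only [M.N_zero, Finset.range_zero, Finset.sum_empty] at hS
    rw [α.K_zero] at hK
    simp only [NNReal.coe_zero]
    linarith
  · rcases le_max_iff.mp (hα.dividends_le_max (ω := ω) ht0) with hZ | hZ
    · rw [reserve] at hZ
      linarith
    · linarith [leftLim_dividends_le ht0 ht]

lemma IsAdmissible.dividends_le (hα : IsAdmissible M c x α) (hx : 0 ≤ x) (hc : 0 ≤ c)
    (hY : ∀ k, 0 ≤ M.Y k ω) (ht : (t : ℝ≥0∞) ≤ ruinTime M c x α ω) {ε : ℝ≥0} :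
    α.Z t ω ≤ Function.rightLim (fun s => α.K s ω) t + (x + c * ε +
      max (c * t - aggregateClaims M ε ω) 0) := by
  have hZ := hα.dividends_add_claims_le hx hY ht
  have hcε : 0 ≤ c * ε := by positivity
  rcases le_or_gt t ε with htε | hεt
  · have hS := Finset.sum_nonneg fun k
      (_ : k ∈ Finset.range (Function.leftLim (fun s => M.N s ω) t)) => hY k
    have hct : c * t ≤ c * ε := by gcongr
    linarith [le_max_right (c * t - aggregateClaims M ε ω) 0]
  · have hS : aggregateClaims M ε ω ≤
        ∑ k ∈ Finset.range (Function.leftLim (fun s => M.N s ω) t), M.Y k ω :=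
      Finset.sum_le_sum_of_subset_of_nonneg
        (Finset.range_subset_range.mpr ((M.N_mono ω).le_leftLim hεt)) fun k _ _ => hY k
    linarith [le_max_left (c * t - aggregateClaims M ε ω) 0]

end Surplus

section ClaimCount

variable {Ω : Type*} [mΩ : MeasurableSpace Ω] {P : Measure Ω} {a b η : ℝ} {f : ℝ → ℝ} {y : ℝ}
  (M : HawkesClaims P a b η f y)

/-- The random set of the times before which (strictly) at least `n` claims have occurred. -/
def claimsBefore (n : ℕ) : Set (ℝ≥0 × Ω) := {p | ∃ s < p.1, n ≤ M.N s p.2}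

lemma measurableSet_claimsBefore (n : ℕ) : MeasurableSet[M.𝔽.predictable] (claimsBefore M n) := by
  have hdense : claimsBefore M n = ⋃ i, Set.Ioi (TopologicalSpace.denseSeq ℝ≥0 i) ×ˢ
      {ω | n ≤ M.N (TopologicalSpace.denseSeq ℝ≥0 i) ω} := by
    ext ⟨t, ω⟩
    simp only [claimsBefore, Set.mem_ofPred_eq, Set.mem_iUnion, Set.mem_prod, Set.mem_Ioi]
    refine ⟨fun ⟨s, hst, hs⟩ => ?_, fun ⟨i, hi⟩ => ⟨_, hi⟩⟩
    obtain ⟨_, ⟨i, rfl⟩, hi⟩ := (TopologicalSpace.denseRange_denseSeq ℝ≥0).exists_between hst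
    exact ⟨i, hi.2, hs.trans (M.N_mono ω hi.1.le)⟩
  rw [hdense]
  exact .iUnion fun i => measurableSet_predictable_Ioi_prod (M.N_adapted _ measurableSet_Ici)

lemma lt_N_claimTime {k : ℕ} {ω : Ω} (h : ∃ t, k < M.N t ω) :
    k < M.N (claimTime M.N k ω) ω := by
  have hgt : ∀ᶠ s in 𝓝[>] claimTime M.N k ω, k < M.N s ω := by
    filter_upwards [self_mem_nhdsWithin] with s hs
    obtain ⟨u, hu, hus⟩ := exists_lt_of_csInf_lt h hs
    exact lt_of_lt_of_le hu (M.N_mono ω hus.le)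
  have hlim : Tendsto (fun s => M.N s ω) (𝓝[>] claimTime M.N k ω) _ :=
    ((M.N_rightCont ω _).mono Set.Ioi_subset_Ici_self).tendsto
  exact ge_of_tendsto hlim hgt

lemma claimTime_mem_claimsBefore {k n : ℕ} (hnk : n ≤ k) {ω : Ω} (h : ∃ t, k < M.N t ω) :
    (claimTime M.N k ω, ω) ∈ claimsBefore M n := by
  have hk := lt_N_claimTime M h
  have hpos : 0 < claimTime M.N k ω := by
    refine pos_iff_ne_zero.mpr fun h0 => ?_
    rw [h0, M.N_zero] at hk
    exact Nat.not_lt_zero k hk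
  obtain ⟨s, hs, hN⟩ := M.N_jump ω _ hpos
  exact ⟨s, hs, by lia⟩

include M in
lemma isProbabilityMeasure_claimLaw [IsProbabilityMeasure P] :
    IsProbabilityMeasure (claimLaw f) := by
  rw [← M.Y_law 0]
  exact Measure.isProbabilityMeasure_map (M.Y_measurable 0).aemeasurable

lemma lintegral_sumOverClaims_indicator [IsProbabilityMeasure P] {D : Set (ℝ≥0 × Ω)}
    (hD : MeasurableSet[M.𝔽.predictable] D) :
    ∫⁻ ω, sumOverClaims M.N M.Y (fun p => D.indicator 1 p.1) ω ∂P =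
      ∫⁻ ω, (∫⁻ s in Set.Ioi (0 : ℝ), D.indicator 1 (s.toNNReal, ω) *
        ENNReal.ofReal (M.lam s.toNNReal ω)) ∂P := by
  have := isProbabilityMeasure_claimLaw M
  have hmeas : Measurable[M.𝔽.predictable] (D.indicator (1 : ℝ≥0 × Ω → ℝ≥0∞)) :=
    measurable_const.indicator hD
  have hH : Measurable[MeasurableSpace.prod M.𝔽.predictable (borel ℝ)]
      fun p : (ℝ≥0 × Ω) × ℝ => D.indicator (1 : ℝ≥0 × Ω → ℝ≥0∞) p.1 :=
    hmeas.comp (@measurable_fst _ _ M.𝔽.predictable (borel ℝ))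
  simpa only [lintegral_const, measure_univ, mul_one] using M.intensity _ hH

lemma lintegral_lam_le_of_claimTime_notMem [IsProbabilityMeasure P] {D : Set (ℝ≥0 × Ω)}
    (hD : MeasurableSet[M.𝔽.predictable] D) {n : ℕ}
    (hn : ∀ k ≥ n, ∀ ω, (∃ t, k < M.N t ω) → (claimTime M.N k ω, ω) ∉ D) :
    ∫⁻ ω, (∫⁻ s in Set.Ioi (0 : ℝ), D.indicator 1 (s.toNNReal, ω) *
      ENNReal.ofReal (M.lam s.toNNReal ω)) ∂P ≤ n := by
  rw [← lintegral_sumOverClaims_indicator M hD]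
  suffices h : ∀ ω, sumOverClaims M.N M.Y (fun p => D.indicator 1 p.1) ω ≤ n from
    (lintegral_mono h).trans_eq (by simp)
  intro ω
  rw [sumOverClaims, tsum_eq_sum (s := Finset.range n)]
  · refine (Finset.sum_le_card_nsmul _ _ 1 fun k _ => ?_).trans_eq (by simp)
    split_ifs
    · exact Set.indicator_apply_le fun _ => le_rfl
    · exact zero_le_one
  · intro k hk
    split_ifs with h
    · exact Set.indicator_of_notMem (hn k (by simpa using hk) ω h) _
    · rfl

lemma le_lam_add_mul_integral_lam {t ε : ℝ≥0} {n : ℕ} {ω : Ω} (ht : t ≤ ε) (hN : M.N ε ω ≤ n) :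
    y - |a * b| * ε - |η| * n ≤ M.lam t ω + a * ∫ s in (0 : ℝ)..t, M.lam s.toNNReal ω := by
  have hlam := M.lam_eq ω t
  rw [intervalIntegral.integral_const_mul, intervalIntegral.integral_sub
    intervalIntegrable_const (M.lam_intervalIntegrable ω t), intervalIntegral.integral_const,
    smul_eq_mul, sub_zero] at hlam
  have hb : |a * b * t| ≤ |a * b| * ε := by
    rw [abs_mul, NNReal.abs_eq]
    gcongr
  have hη : |η * M.N t ω| ≤ |η| * n := by
    rw [abs_mul, Nat.abs_cast]
    gcongr
    exact (M.N_mono ω ht).trans hN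
  linarith [neg_abs_le (a * b * t), neg_abs_le (η * M.N t ω)]

lemma le_lintegral_lam {ε : ℝ≥0} {n : ℕ} {ω : Ω} (hN : M.N ε ω ≤ n) :
    ENNReal.ofReal ((y - |a * b| * ε - |η| * n) * ∫ s in (0 : ℝ)..ε, Real.exp (a * (s - ε))) ≤
      ∫⁻ s in Set.Ioc (0 : ℝ) ε, ENNReal.ofReal (M.lam s.toNNReal ω) := by
  have hlam := M.lam_intervalIntegrable ω ε
  refine (ENNReal.ofReal_le_ofReal (mul_integral_exp_le_integral ε.coe_nonneg hlam ?_)).trans ?_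
  · intro t ht
    lift t to ℝ≥0 using ht.1
    rw [Real.toNNReal_coe]
    exact le_lam_add_mul_integral_lam M (NNReal.coe_le_coe.mp ht.2) hN
  · rw [intervalIntegral.integral_of_le ε.coe_nonneg]
    exact ofReal_integral_le_lintegral hlam.1

lemma measurableSet_N_lt (ε : ℝ≥0) (n : ℕ) : MeasurableSet {ω | M.N ε ω < n} :=
  M.𝔽.le ε _ (M.N_adapted ε measurableSet_Iio)

lemma measure_N_lt_mul_le [IsProbabilityMeasure P] (ε : ℝ≥0) (n : ℕ) :
    P {ω | M.N ε ω < n} * ENNReal.ofReal ((y - |a * b| * ε - |η| * n) *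
      ∫ s in (0 : ℝ)..ε, Real.exp (a * (s - ε))) ≤ n := by
  set D : Set (ℝ≥0 × Ω) := (Set.Ioc 0 ε ×ˢ Set.univ) \ claimsBefore M n
  have hD : MeasurableSet[M.𝔽.predictable] D :=
    (measurableSet_predictable_Ioc_prod 0 ε .univ).diff (measurableSet_claimsBefore M n)
  refine le_trans ?_ (lintegral_lam_le_of_claimTime_notMem M hD fun k hk ω h hmem =>
    hmem.2 (claimTime_mem_claimsBefore M hk h))
  rw [mul_comm, ← setLIntegral_const]
  refine (setLIntegral_mono' (measurableSet_N_lt M ε n) fun ω hω =>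
    (le_lintegral_lam M (le_of_lt hω)).trans ?_).trans (setLIntegral_le_lintegral _ _)
  refine (setLIntegral_congr_fun measurableSet_Ioc fun s hs => ?_).trans_le
    (lintegral_mono_set Set.Ioc_subset_Ioi_self)
  have hsε : s.toNNReal ≤ ε := Real.toNNReal_le_iff_le_coe.mpr hs.2
  have hmem : (s.toNNReal, ω) ∈ D := by
    refine ⟨⟨⟨Real.toNNReal_pos.mpr hs.1, hsε⟩, trivial⟩, fun ⟨u, hu, hn⟩ => ?_⟩
    exact (hn.trans (M.N_mono ω (hu.le.trans hsε))).not_gt hω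
  simp only [Set.indicator_of_mem hmem, Pi.one_apply, one_mul]

end ClaimCount

section AggregateClaims

variable {Ω : Type*} [mΩ : MeasurableSpace Ω] {P : Measure Ω} {a b η : ℝ} {f : ℝ → ℝ} {y θ : ℝ}
  (M : HawkesClaims P a b η f y)

lemma measurable_aggregateClaims (t : ℝ≥0) : Measurable (aggregateClaims M t) :=
  (M.claims_adapted t).mono (M.𝔽.le t) le_rfl

lemma lintegral_exp_neg_mul_aggregateClaims_le (hθ : 0 ≤ θ) (ε : ℝ≥0) (n : ℕ) :
    ∫⁻ ω, ENNReal.ofReal (Real.exp (-θ * aggregateClaims M ε ω)) ∂P ≤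
      P {ω | M.N ε ω < n} + claimLaplace f θ ^ n := by
  have hA := measurableSet_N_lt M ε n
  rw [← lintegral_exp_neg_mul_sum_claims M, ← lintegral_indicator_one hA,
    ← lintegral_add_left (measurable_one.indicator hA)]
  refine lintegral_mono_ae ?_
  filter_upwards [ae_all_iff.mpr M.Y_pos] with ω hY
  by_cases hN : M.N ε ω < n
  · refine le_add_right ?_
    rw [Set.indicator_of_mem (by exact hN), Pi.one_apply, ENNReal.ofReal_le_one,
      Real.exp_le_one_iff, neg_mul, neg_nonpos]
    exact mul_nonneg hθ (Finset.sum_nonneg fun k _ => (hY k).le)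
  · refine le_add_left (ENNReal.ofReal_le_ofReal (Real.exp_le_exp.mpr ?_))
    exact mul_le_mul_of_nonpos_left (Finset.sum_le_sum_of_subset_of_nonneg
      (Finset.range_subset_range.mpr (not_lt.mp hN)) fun k _ _ => (hY k).le) (neg_nonpos.mpr hθ)

end AggregateClaims

section HighIntensity

variable {ι : Type*} {F : Filter ι} {Ω : ι → Type*} [∀ i, MeasurableSpace (Ω i)]
  {P : ∀ i, Measure (Ω i)} [∀ i, IsProbabilityMeasure (P i)] {a b η : ℝ} {f : ℝ → ℝ}
  {y : ι → ℝ} (hy : Tendsto y F atTop) (M : ∀ i, HawkesClaims (P i) a b η f (y i)) {ε : ℝ≥0}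

include hy in
lemma tendsto_measure_N_lt (hε : 0 < ε) (n : ℕ) :
    Tendsto (fun i => P i {ω | (M i).N ε ω < n}) F (𝓝 0) := by
  have hbound : Tendsto (fun i => ENNReal.ofReal ((y i - |a * b| * ε - |η| * n) *
      ∫ s in (0 : ℝ)..ε, Real.exp (a * (s - ε)))) F (𝓝 ∞) := by
    refine ENNReal.tendsto_ofReal_atTop.comp
      (Tendsto.atTop_mul_const (integral_exp_mul_sub_pos (NNReal.coe_pos.mpr hε)) ?_)
    simp_rw [sub_eq_add_neg]
    exact tendsto_atTop_add_const_right _ _ (tendsto_atTop_add_const_right _ _ hy)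
  have hquot := ENNReal.Tendsto.const_div hbound (.inr (ENNReal.natCast_ne_top n))
  rw [ENNReal.div_top] at hquot
  refine tendsto_of_tendsto_of_tendsto_of_le_of_le' tendsto_const_nhds hquot
    (.of_forall fun _ => zero_le) ?_
  filter_upwards [hbound.eventually_const_lt ENNReal.zero_lt_top] with i hi
  rw [ENNReal.le_div_iff_mul_le (.inl hi.ne') (.inl ENNReal.ofReal_ne_top)]
  exact measure_N_lt_mul_le (M i) ε n

include hy in
lemma tendsto_lintegral_exp_neg_mul_aggregateClaims {θ : ℝ} (hθ : 0 < θ) (hε : 0 < ε) :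
    Tendsto (fun i => ∫⁻ ω, ENNReal.ofReal (Real.exp (-θ * aggregateClaims (M i) ε ω)) ∂P i)
      F (𝓝 0) := by
  rcases isEmpty_or_nonempty ι with _ | ⟨⟨i₀⟩⟩
  · exact tendsto_of_isEmpty
  rw [ENNReal.tendsto_nhds_zero]
  intro e he
  obtain ⟨n, hn⟩ := ((ENNReal.tendsto_pow_atTop_nhds_zero_of_lt_one
    (claimLaplace_lt_one (M i₀) hθ)).eventually_lt_const (ENNReal.half_pos he.ne')).exists
  filter_upwards [(tendsto_measure_N_lt hy M hε n).eventually_lt_const (ENNReal.half_pos he.ne')]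
    with i hi
  calc _ ≤ P i {ω | (M i).N ε ω < n} + claimLaplace f θ ^ n :=
        lintegral_exp_neg_mul_aggregateClaims_le (M i) hθ.le ε n
    _ ≤ e / 2 + e / 2 := add_le_add hi.le hn.le
    _ = e := ENNReal.add_halves e

end HighIntensity

section Value

variable {Ω : Type*} [mΩ : MeasurableSpace Ω] {P : Measure Ω}
  {a b η : ℝ} {f : ℝ → ℝ} {y : ℝ} {M : HawkesClaims P a b η f y} {c ρ δ x : ℝ}

lemma reward_le_of_le {α : Strategy M.𝔽} (hδ : 1 ≤ δ) {r : ℝ≥0∞}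
    (h : expectedDividends M c ρ x α ≤ expectedInjections M c ρ x α + r) :
    reward M c ρ δ x α ≤ r := by
  rw [reward]
  have hδ0 : (0 : EReal) < δ := by exact_mod_cast zero_lt_one.trans_le hδ
  rcases eq_or_ne (expectedInjections M c ρ x α) ∞ with hI | hI
  · simp [hI, EReal.mul_top_of_pos hδ0]
  lift expectedInjections M c ρ x α to ℝ≥0 using hI with I
  have hδI : ((I : ℝ) : EReal) ≤ (δ : EReal) * (I : ℝ) := by
    rw [← EReal.coe_mul, EReal.coe_le_coe_iff]
    exact le_mul_of_one_le_left I.coe_nonneg hδ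
  calc (expectedDividends M c ρ x α : EReal) - δ * (I : ℝ)
      ≤ ((r + I : ℝ≥0∞) : EReal) - (I : ℝ) :=
        EReal.sub_le_sub (EReal.coe_ennreal_le_coe_ennreal_iff.mpr (add_comm r I ▸ h)) hδI
    _ = r := by
        rw [EReal.coe_ennreal_add]
        exact EReal.add_sub_cancel_right

lemma IsAdmissible.ofReal_rightLim_dividends_le {α : Strategy M.𝔽} (hα : IsAdmissible M c x α)
    (hc : 0 ≤ c) (hx : 0 ≤ x) {ω : Ω} (hY : ∀ k, 0 ≤ M.Y k ω) (ε : ℝ≥0) {r : ℝ≥0} {t : ℝ}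
    (hrT : (r : ℝ≥0∞) ≤ ruinTime M c x α ω) (hrt : (r : ℝ) ≤ t) :
    ENNReal.ofReal (Function.rightLim (fun s => α.Z s ω) r) ≤
      ENNReal.ofReal (Function.rightLim (fun s => α.K s ω) r) +
        (ENNReal.ofReal (x + c * ε) + ENNReal.ofReal (c * t - aggregateClaims M ε ω)) := by
  have hcont : ContinuousWithinAt (fun s => α.Z s ω) (Set.Ioi r) r :=
    (α.Z_rightCont ω r).mono Set.Ioi_subset_Ici_self
  have hZ : Function.rightLim (fun s => α.Z s ω) r = α.Z r ω :=
    rightLim_eq_of_tendsto hcont.tendsto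
  have hmono : max (c * r - aggregateClaims M ε ω) 0 ≤ max (c * t - aggregateClaims M ε ω) 0 := by
    gcongr
  calc ENNReal.ofReal (Function.rightLim (fun s => α.Z s ω) r)
      ≤ ENNReal.ofReal (Function.rightLim (fun s => α.K s ω) r +
          (x + c * ε + max (c * t - aggregateClaims M ε ω) 0)) :=
        ENNReal.ofReal_le_ofReal (by linarith [hα.dividends_le hx hc hY hrT (ε := ε)])
    _ ≤ ENNReal.ofReal (Function.rightLim (fun s => α.K s ω) r) +
          (ENNReal.ofReal (x + c * ε) + ENNReal.ofReal (max (c * t - aggregateClaims M ε ω) 0)) :=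
        ENNReal.ofReal_add_le.trans (add_le_add_right ENNReal.ofReal_add_le _)
    _ = _ := by rw [ENNReal.ofReal_max, ENNReal.ofReal_zero, max_eq_left zero_le]

lemma IsAdmissible.discountedDividends_le {α : Strategy M.𝔽} (hα : IsAdmissible M c x α)
    (hc : 0 < c) (hρ : 0 < ρ) (hx : 0 ≤ x) {ω : Ω} (hY : ∀ k, 0 ≤ M.Y k ω) (ε : ℝ≥0) :
    ∫⁻ s in untilRuin M c x α ω, ENNReal.ofReal (Real.exp (-ρ * s))
        ∂pathMeasure (fun t => α.Z t ω) (α.Z_mono ω) (α.Z_zero ω) ≤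
      ∫⁻ s in untilRuin M c x α ω, ENNReal.ofReal (Real.exp (-ρ * s))
          ∂pathMeasure (fun t => α.K t ω) (α.K_mono ω) (α.K_zero ω).ge +
        (ENNReal.ofReal (x + c * ε) + ENNReal.ofReal (c / ρ) *
          ENNReal.ofReal (Real.exp (-(ρ / c) * aggregateClaims M ε ω))) := by
  have := isProbabilityMeasure_expMeasure hρ
  have hconst : ENNReal.ofReal (x + c * ε) = ∫⁻ _, ENNReal.ofReal (x + c * ε) ∂expMeasure ρ := by
    simp
  have hS : 0 ≤ aggregateClaims M ε ω := Finset.sum_nonneg fun k _ => hY k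
  rw [untilRuin, setLIntegral_exp_neg_mul_pathMeasure (α.Z_mono ω) (α.Z_zero ω) hρ,
    setLIntegral_exp_neg_mul_pathMeasure (α.K_mono ω) (α.K_zero ω).ge hρ,
    ← lintegral_ofReal_mul_sub_expMeasure hρ hc hS, hconst, ← lintegral_add_left measurable_const,
    ← lintegral_add_right _ (by fun_prop)]
  refine lintegral_mono_ae ?_
  filter_upwards [ae_expMeasure_nonneg hρ] with t ht
  have hmin : ((min (ENNReal.ofReal t) (ruinTime M c x α ω)).toNNReal : ℝ≥0∞) = _ :=
    ENNReal.coe_toNNReal (ne_top_of_le_ne_top ENNReal.ofReal_ne_top inf_le_left)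
  exact hα.ofReal_rightLim_dividends_le hc.le hx hY ε (hmin.trans_le inf_le_right)
    ((Real.le_toNNReal_iff_coe_le ht).mp (ENNReal.coe_le_coe.mp (hmin.trans_le inf_le_left)))

lemma IsAdmissible.expectedDividends_le {α : Strategy M.𝔽} [IsProbabilityMeasure P]
    (hα : IsAdmissible M c x α) (hc : 0 < c) (hρ : 0 < ρ) (hx : 0 ≤ x) (ε : ℝ≥0) :
    expectedDividends M c ρ x α ≤ expectedInjections M c ρ x α + (ENNReal.ofReal (x + c * ε) +
      ENNReal.ofReal (c / ρ) *
        ∫⁻ ω, ENNReal.ofReal (Real.exp (-(ρ / c) * aggregateClaims M ε ω)) ∂P) := by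
  have hS := measurable_aggregateClaims M ε
  have hconst : ENNReal.ofReal (x + c * ε) = ∫⁻ _, ENNReal.ofReal (x + c * ε) ∂P := by simp
  rw [hconst, ← lintegral_const_mul _ (by fun_prop), ← lintegral_add_left measurable_const,
    expectedInjections, ← lintegral_add_right _ (by fun_prop)]
  refine lintegral_mono_ae ?_
  filter_upwards [ae_all_iff.mpr M.Y_pos] with ω hY
  exact hα.discountedDividends_le hc hρ hx (fun k => (hY k).le) ε

/-- The strategy paying the whole initial surplus at time `0` and nothing afterwards. -/
def payInitialSurplus (𝔽 : Filtration ℝ≥0 mΩ) (hx : 0 ≤ x) : Strategy 𝔽 where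
  Z _ _ := x
  K _ _ := 0
  Z_adapted _ := measurable_const
  Z_mono _ := monotone_const
  Z_rightCont _ _ := continuousWithinAt_const
  Z_zero _ := hx
  K_adapted _ := measurable_const
  K_mono _ := monotone_const
  K_leftCont _ _ := continuousWithinAt_const
  K_zero _ := rfl

variable (M)

lemma isAdmissible_payInitialSurplus (hx : 0 ≤ x) :
    IsAdmissible M c x (payInitialSurplus M.𝔽 hx) := by
  refine fun ω => ⟨le_max_left _ _, fun t ht => ?_⟩
  have h : Function.leftLim (fun _ : ℝ≥0 => x) t = x :=
    have := nhdsLT_neBot_of_exists_lt ⟨0, ht⟩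
    continuousWithinAt_const.leftLim_eq
  simp [payInitialSurplus, h]

lemma expectedInjections_payInitialSurplus (hρ : 0 < ρ) (hx : 0 ≤ x) :
    expectedInjections M c ρ x (payInitialSurplus M.𝔽 hx) = 0 := by
  simp_rw [expectedInjections, untilRuin, setLIntegral_exp_neg_mul_pathMeasure _ _ hρ]
  simp [payInitialSurplus, continuousWithinAt_const.rightLim_eq]

variable [IsProbabilityMeasure P]

lemma expectedDividends_payInitialSurplus (hρ : 0 < ρ) (hx : 0 ≤ x) :
    expectedDividends M c ρ x (payInitialSurplus M.𝔽 hx) = ENNReal.ofReal x := by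
  have := isProbabilityMeasure_expMeasure hρ
  simp_rw [expectedDividends, untilRuin, setLIntegral_exp_neg_mul_pathMeasure _ _ hρ]
  simp [payInitialSurplus, continuousWithinAt_const.rightLim_eq]

lemma value_le (hc : 0 < c) (hρ : 0 < ρ) (hδ : 1 ≤ δ) (hx : 0 ≤ x) (ε : ℝ≥0) :
    value M c ρ δ x ≤ ((ENNReal.ofReal (x + c * ε) + ENNReal.ofReal (c / ρ) *
      ∫⁻ ω, ENNReal.ofReal (Real.exp (-(ρ / c) * aggregateClaims M ε ω)) ∂P : ℝ≥0∞) : EReal) :=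
  iSup₂_le fun _ hα => reward_le_of_le hδ (hα.expectedDividends_le hc hρ hx ε)

lemma le_value (hρ : 0 < ρ) (hx : 0 ≤ x) : (x : EReal) ≤ value M c ρ δ x := by
  refine le_iSup₂_of_le (payInitialSurplus M.𝔽 hx) (isAdmissible_payInitialSurplus M hx) ?_
  simp [reward, expectedDividends_payInitialSurplus M hρ,
    expectedInjections_payInitialSurplus M hρ, max_eq_left hx]

end Value

end DividendHawkes

theorem mainTheorem7_general {ι : Type*} {l : Filter ι} {Ω : ι → Type*}
    [∀ i, MeasurableSpace (Ω i)] {P : ∀ i, Measure (Ω i)} [∀ i, IsProbabilityMeasure (P i)]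
    {a b η c ρ δ x : ℝ} {f : ℝ → ℝ} (hc : 0 < c) (hρ : 0 < ρ) (hδ : 1 ≤ δ) (hx : 0 ≤ x)
    {y : ι → ℝ} (hy : Tendsto y l atTop)
    (M : ∀ i, DividendHawkes.HawkesClaims (P i) a b η f (y i)) :
    Tendsto (fun i => DividendHawkes.value (M i) c ρ δ x) l (𝓝 (x : EReal)) := by
  refine tendsto_order.2 ⟨fun u hu => .of_forall fun i =>
    hu.trans_le (DividendHawkes.le_value (M i) hρ hx), fun u hu => ?_⟩
  have hcont : Tendsto (fun ε : ℝ≥0 => ((ENNReal.ofReal (x + c * ε) : ℝ≥0∞) : EReal)) (𝓝[>] 0)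
      (𝓝 (x : EReal)) := by
    have h : Continuous fun ε : ℝ≥0 => ((ENNReal.ofReal (x + c * ε) : ℝ≥0∞) : EReal) :=
      continuous_coe_ennreal_ereal.comp (ENNReal.continuous_ofReal.comp (by fun_prop))
    simpa [hx] using (h.tendsto 0).mono_left nhdsWithin_le_nhds
  obtain ⟨ε, hεu, hε⟩ := ((hcont.eventually_lt_const hu).and self_mem_nhdsWithin).exists
  have hbound := tendsto_const_nhds (x := ENNReal.ofReal (x + c * ε)) |>.add
    (ENNReal.Tendsto.const_mul (DividendHawkes.tendsto_lintegral_exp_neg_mul_aggregateClaims hy M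
      (div_pos hρ hc) hε) (.inr (ENNReal.ofReal_ne_top (r := c / ρ))))
  rw [mul_zero, add_zero] at hbound
  have hbound' := (continuous_coe_ennreal_ereal.tendsto _).comp hbound
  filter_upwards [hbound'.eventually_lt_const hεu] with i hi
  exact (DividendHawkes.value_le (M i) hc hρ hδ hx ε).trans_lt hi

theorem mainTheorem7 {Ω : Type*} [MeasurableSpace Ω] (P : Measure Ω) [IsProbabilityMeasure P]
    (a b η c ρ δ : ℝ) (ha : 0 < a) (hb : 0 < b) (hη : 0 < η) (hc : 0 < c) (hρ : 0 < ρ)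
    (hδ : 1 < δ) (f : ℝ → ℝ) (hf : Measurable f) (hf0 : ∀ z, 0 ≤ f z)
    (M : ∀ y : Set.Ici b, DividendHawkes.HawkesClaims P a b η f y)
    (x : ℝ) (hx : 0 ≤ x) :
    Tendsto (fun y : Set.Ici b => DividendHawkes.value (M y) c ρ δ x) atTop (𝓝 (x : EReal)) :=
  mainTheorem7_general hc hρ hδ.le hx (tendsto_comp_val_Ici_atTop.mpr tendsto_id) M
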